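/- Let $l,w\ge 0$ be integers and $i\in\{1,2\}$. Let $\mathcal V_{l,w}$ be the set of lattice points $A_{x,y}=(x,y)\in\mathbb Z^2$ with $0\le x\le l$, $0\le y\le w$, and let $\mathcal E_{l,w}$ be the set of line segments $A_{x,y}A_{x',y'}$ with end points in $\mathcal V_{l,w}$ and $|x-x'|=|y-y'|=1$. The hammock network $H^{(i)}_{l,w}=(V^{(i)}_{l,w},E^{(i)}_{l,w})$ consists of the points of $\mathcal V_{l,w}$ with $x+y$ even (if $i=1$), respectively odd (if $i=2$), and of the segments in $\mathcal E_{l,w}$ joining such points; its source nodes are its nodes with $x=0$ and its terminus nodes are its nodes with $x=l$. The dual network $\overline{H^{(i)}_{l,w}}$ has node set $\mathcal V_{l,w}\setminus V^{(i)}_{l,w}$ and edge set $\mathcal E_{l,w}\setminus E^{(i)}_{l,w}$; its source nodes are its nodes with $y=0$ and its terminus nodes are its nodes with $y=w$. For an edge $e=A_{x,y}A_{x+1,y\pm1}$ the complementary edge is $\bar e=A_{x+1,y}A_{x,y\pm1}$. An X-path is a lattice path with steps in $\{(\pm1,\pm1)\}$ that visits pairwise distinct points, identified with the set of segments it consists of.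 A set $P$ of edges of a network is a pathset if it contains an X-path from a source node to a terminus node; a set $C$ of edges is a cutset if the set of all edges of the network not in $C$ contains no such X-path. Let $\Sigma\subseteq E^{(i)}_{l,w}$ and let $\overline\Sigma=\{\bar e: e\in\Sigma\}$. Then $\overline\Sigma$ is a set of edges of $\overline{H^{(i)}_{l,w}}$, and $\Sigma$ is a pathset in $H^{(i)}_{l,w}$ if and only if $\overline\Sigma$ is a cutset in $\overline{H^{(i)}_{l,w}}$. -/

import Mathlib

namespace Hammock

/-- Points of the integer lattice, the point `A_{x,y}` being `(x, y)`. -/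
abbrev Point : Type := ℤ × ℤ

/-- Edges are line segments between two lattice points, given by their unordered pair of
end points. -/
abbrev Edge : Type := Sym2 Point

/-- The four diagonal steps. -/
def steps : Set Point := {(1, 1), (-1, 1), (1, -1), (-1, -1)}

/-- The graph on the whole lattice in which each point is joined to its four diagonal
neighbours. Its walks are exactly the lattice paths with steps in `steps`. -/
def xGraph : SimpleGraph Point where
  Adj u v := v - u ∈ steps
  symm := ⟨by
    rintro ⟨a, b⟩ ⟨c, d⟩ h
    simp only [steps, Set.mem_insert_iff, Set.mem_singleton_iff, Prod.mk_sub_mk,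
      Prod.mk.injEq] at h ⊢
    omega⟩
  loopless := ⟨by
    rintro ⟨a, b⟩ h
    simp [steps, Prod.ext_iff] at h⟩

/-- An X-path from `u` to `v`: a lattice path with diagonal steps all of whose points are
distinct. -/
abbrev XPath (u v : Point) : Type := xGraph.Path u v

/-- The set of line segments that make up an X-path. -/
def XPath.segments {u v : Point} (p : XPath u v) : Set Edge := {e | e ∈ p.1.edges}

/-- A network drawn on the lattice: nodes, edges, source nodes, terminus nodes. -/
structure Network where
  nodes : Set Point
  edges : Set Edge
  sources : Set Point
  targets : Set Point

/-- The set of edges `P` contains an X-path from a source node to a terminus node of `N`. -/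
def Network.Connects (N : Network) (P : Set Edge) : Prop :=
  ∃ s ∈ N.sources, ∃ t ∈ N.targets, ∃ p : XPath s t, p.segments ⊆ P

/-- Pathsets of a network. -/
def Network.IsPathset (N : Network) (P : Set Edge) : Prop :=
  P ⊆ N.edges ∧ N.Connects P

/-- Cutsets of a network. -/
def Network.IsCutset (N : Network) (C : Set Edge) : Prop :=
  C ⊆ N.edges ∧ ¬ N.Connects (N.edges \ C)

/-- The two kinds of hammock networks. -/
inductive Kind where
  | first
  | second

/-- Points of the parity that belongs to a kind: even for the first, odd for the second. -/
def Kind.HasParity : Kind → Point → Prop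
  | .first, a => Even (a.1 + a.2)
  | .second, a => Odd (a.1 + a.2)

/-- All lattice points of the rectangle `[0, l] × [0, w]`. -/
def allNodes (l w : ℕ) : Set Point :=
  {a | 0 ≤ a.1 ∧ a.1 ≤ l ∧ 0 ≤ a.2 ∧ a.2 ≤ w}

/-- All diagonal segments between lattice points of the rectangle. -/
def allEdges (l w : ℕ) : Set Edge :=
  {e | ∃ a b : Point, a ∈ allNodes l w ∧ b ∈ allNodes l w ∧
    |a.1 - b.1| = 1 ∧ |a.2 - b.2| = 1 ∧ e = s(a, b)}

/-- The points of the rectangle of the parity that belongs to `i`. -/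
def kindNodes (l w : ℕ) (i : Kind) : Set Point :=
  {a | a ∈ allNodes l w ∧ i.HasParity a}

/-- The diagonal segments in the rectangle with end points of the parity that belongs to `i`
(the two end points of a diagonal segment have the same parity). -/
def kindEdges (l w : ℕ) (i : Kind) : Set Edge :=
  {e | e ∈ allEdges l w ∧ ∀ a ∈ e, i.HasParity a}

/-- The hammock network of dimensions `(l, w)` of kind `i`; sources on the left side `x = 0`,
terminus nodes on the right side `x = l`. -/
def hammock (l w : ℕ) (i : Kind) : Network where
  nodes := kindNodes l w i
  edges := kindEdges l w i
  sources := {a | a ∈ kindNodes l w i ∧ a.1 = 0}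
  targets := {a | a ∈ kindNodes l w i ∧ a.1 = l}

/-- The dual of the hammock network of dimensions `(l, w)` of kind `i`: complementary nodes and
edges; sources on the bottom side `y = 0`, terminus nodes on the top side `y = w`. -/
def dualHammock (l w : ℕ) (i : Kind) : Network where
  nodes := allNodes l w \ kindNodes l w i
  edges := allEdges l w \ kindEdges l w i
  sources := {a | a ∈ allNodes l w \ kindNodes l w i ∧ a.2 = 0}
  targets := {a | a ∈ allNodes l w \ kindNodes l w i ∧ a.2 = w}

/-- The complementary edge: the segment from `(x, y)` to `(x', y')` goes to the segment from
`(x', y)` to `(x, y')`, the other diagonal of the same unit square. -/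
def compl : Edge → Edge :=
  Sym2.lift ⟨fun a b => s((b.1, a.2), (a.1, b.2)), fun _ _ => Sym2.eq_swap⟩

end Hammock

namespace Hammock

open Relation

/-! Both implications are parity arguments modulo two; no extremal path or planar topology is used.
If neither network connects, label each point by whether it is reached from the sources of its own
network. Of the two diagonals of a unit square, one lies in `S` or the other survives in the dual,
so the labels agree along at least one of them and the product of the two diagonal differences
vanishes. Summed over all squares (`sum_diagonal_products`) this leaves only boundary terms, which
the labels on the four sides force to be one (`exists_square_of_boundary`). Conversely, given a
bottom-top dual path, count modulo two its segments to the left of a point in the row just above it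
(`exists_crossing_count`). With a correction at the path's upper end the count is constant along
`S`, yet it is zero on the left side and one on the right. -/

/-- `Linked P a b`: the segment `ab` belongs to `P`. -/
def Linked (P : Set Edge) (a b : Point) : Prop := s(a, b) ∈ P

lemma xGraph_adj_of_mem_allEdges {l w : ℕ} {a b : Point} (h : s(a, b) ∈ allEdges l w) :
    xGraph.Adj a b := by
  obtain ⟨c, d, -, -, h1, h2, he⟩ := h
  obtain ⟨a1, a2⟩ := a
  obtain ⟨b1, b2⟩ := b
  obtain ⟨c1, c2⟩ := c
  obtain ⟨d1, d2⟩ := d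
  simp only [Sym2.eq_iff, Prod.mk.injEq] at he
  simp only [xGraph, steps, Set.mem_insert_iff, Set.mem_singleton_iff, Prod.mk_sub_mk,
    Prod.mk.injEq]
  rw [abs_eq (by norm_num)] at h1 h2
  omega

lemma reflTransGen_linked_of_walk {P : Set Edge} {a b : Point} (p : xGraph.Walk a b)
    (hp : ∀ e ∈ p.edges, e ∈ P) : ReflTransGen (Linked P) a b := by
  induction p with
  | nil => exact .refl
  | cons h q ih =>
    simp only [SimpleGraph.Walk.edges_cons, List.mem_cons, forall_eq_or_imp] at hp
    exact .head hp.1 (ih hp.2)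

lemma exists_walk_of_reflTransGen {l w : ℕ} {P : Set Edge} (hP : P ⊆ allEdges l w) {a b : Point}
    (h : ReflTransGen (Linked P) a b) : ∃ p : xGraph.Walk a b, ∀ e ∈ p.edges, e ∈ P := by
  induction h using ReflTransGen.head_induction_on with
  | refl => exact ⟨.nil, by simp⟩
  | head hab _ ih =>
    obtain ⟨p, hp⟩ := ih
    refine ⟨.cons (xGraph_adj_of_mem_allEdges (hP hab)) p, ?_⟩
    simp only [SimpleGraph.Walk.edges_cons, List.mem_cons, forall_eq_or_imp]
    exact ⟨hab, hp⟩

/-- Loops can be cut out of a lattice path, so that connection is reachability. -/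
lemma Network.connects_iff {l w : ℕ} {P : Set Edge} (hP : P ⊆ allEdges l w) (N : Network) :
    N.Connects P ↔ ∃ s ∈ N.sources, ∃ t ∈ N.targets, ReflTransGen (Linked P) s t := by
  constructor
  · rintro ⟨s, hs, t, ht, p, hp⟩
    exact ⟨s, hs, t, ht, reflTransGen_linked_of_walk p.1 fun e he => hp he⟩
  · rintro ⟨s, hs, t, ht, h⟩
    obtain ⟨p, hp⟩ := exists_walk_of_reflTransGen hP h
    exact ⟨s, hs, t, ht, p.toPath, fun e he => hp e (p.edges_toPath_subset_edges he)⟩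

/-! ### Complementary edges and parity. -/

lemma compl_mk (a b : Point) : compl s(a, b) = s((b.1, a.2), (a.1, b.2)) := rfl

lemma compl_compl (e : Edge) : compl (compl e) = e := by
  induction e using Sym2.ind with
  | _ a b => rfl

lemma mem_compl_image {S : Set Edge} {e : Edge} : e ∈ compl '' S ↔ compl e ∈ S := by
  constructor
  · rintro ⟨d, hd, rfl⟩
    rwa [compl_compl]
  · exact fun h => ⟨_, h, compl_compl e⟩

/-- Both kinds of parity are a congruence modulo two. -/
lemma Kind.exists_hasParity_iff (i : Kind) :
    ∃ ε : ℤ, ∀ a : Point, i.HasParity a ↔ (a.1 + a.2 + ε) % 2 = 0 := by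
  cases i
  · exact ⟨0, fun a => by simp [HasParity, Int.even_iff]⟩
  · exact ⟨1, fun a => by simp only [HasParity, Int.odd_iff]; omega⟩

lemma mk_mem_allEdges {l w : ℕ} {a b : Point} :
    s(a, b) ∈ allEdges l w ↔ a ∈ allNodes l w ∧ b ∈ allNodes l w ∧
      |a.1 - b.1| = 1 ∧ |a.2 - b.2| = 1 := by
  constructor
  · rintro ⟨c, d, hc, hd, h1, h2, he⟩
    rcases Sym2.eq_iff.1 he with ⟨rfl, rfl⟩ | ⟨rfl, rfl⟩
    · exact ⟨hc, hd, h1, h2⟩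
    · exact ⟨hd, hc, by rwa [abs_sub_comm], by rwa [abs_sub_comm]⟩
  · rintro ⟨ha, hb, h1, h2⟩
    exact ⟨a, b, ha, hb, h1, h2, rfl⟩

section Edges

variable {l w : ℕ} {i : Kind} {ε : ℤ}

lemma mk_mem_kindEdges (hε : ∀ a : Point, i.HasParity a ↔ (a.1 + a.2 + ε) % 2 = 0)
    {a b : Point} : s(a, b) ∈ kindEdges l w i ↔
      s(a, b) ∈ allEdges l w ∧ (a.1 + a.2 + ε) % 2 = 0 := by
  simp only [kindEdges, Set.mem_ofPred_eq, Sym2.mem_iff, forall_eq_or_imp, forall_eq, hε]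
  refine and_congr_right fun h => ?_
  obtain ⟨-, -, h1, h2⟩ := mk_mem_allEdges.1 h
  rw [abs_eq (by norm_num)] at h1 h2
  omega

lemma mk_mem_dual_edges (hε : ∀ a : Point, i.HasParity a ↔ (a.1 + a.2 + ε) % 2 = 0)
    {a b : Point} : s(a, b) ∈ (dualHammock l w i).edges ↔
      s(a, b) ∈ allEdges l w ∧ (a.1 + a.2 + ε) % 2 = 1 := by
  change s(a, b) ∈ allEdges l w \ kindEdges l w i ↔ _
  rw [Set.mem_sdiff, mk_mem_kindEdges hε]
  refine and_congr_right fun h => ?_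
  simp only [h, true_and]
  omega

lemma compl_mem_dual_edges {e : Edge} (he : e ∈ kindEdges l w i) :
    compl e ∈ (dualHammock l w i).edges := by
  obtain ⟨ε, hε⟩ := i.exists_hasParity_iff
  induction e using Sym2.ind with
  | _ a b =>
    rw [mk_mem_kindEdges hε, mk_mem_allEdges] at he
    obtain ⟨⟨ha, hb, h1, h2⟩, h3⟩ := he
    rw [compl_mk, mk_mem_dual_edges hε, mk_mem_allEdges]
    rw [abs_eq (by norm_num)] at h1 h2
    simp only [abs_eq (zero_le_one' ℤ)]
    simp only [allNodes, Set.mem_ofPred_eq] at *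
    omega

lemma mk_mem_dual_edges_diff (hε : ∀ a : Point, i.HasParity a ↔ (a.1 + a.2 + ε) % 2 = 0)
    {S : Set Edge} {a b : Point} : s(a, b) ∈ (dualHammock l w i).edges \ compl '' S ↔
      (s(a, b) ∈ allEdges l w ∧ (a.1 + a.2 + ε) % 2 = 1) ∧
        s((b.1, a.2), (a.1, b.2)) ∉ S := by
  rw [Set.mem_sdiff, mk_mem_dual_edges hε, mem_compl_image, compl_mk]

end Edges

/-! ### A discrete Stokes formula and its boundary terms. -/

lemma sum_range_add_succ (f : ℕ → ZMod 2) (n : ℕ) :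
    ∑ k ∈ Finset.range n, (f k + f (k + 1)) = f 0 + f n := by
  induction n with
  | zero => simp [CharTwo.add_self_eq_zero]
  | succ n ih =>
    rw [Finset.sum_range_succ, ih]
    linear_combination CharTwo.add_self_eq_zero (f n)

/-- A discrete Stokes formula modulo two: the products of the two diagonal sums over all unit
squares add up to the products along the sides of the rectangle. -/
lemma sum_diagonal_products (f : ℕ → ℕ → ZMod 2) (l w : ℕ) :
    ∑ x ∈ Finset.range l, ∑ y ∈ Finset.range w,
        (f x y + f (x + 1) (y + 1)) * (f (x + 1) y + f x (y + 1)) =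
      (∑ y ∈ Finset.range w, f 0 y * f 0 (y + 1) + ∑ y ∈ Finset.range w, f l y * f l (y + 1)) +
      (∑ x ∈ Finset.range l, f x 0 * f (x + 1) 0 +
        ∑ x ∈ Finset.range l, f x w * f (x + 1) w) := by
  -- The cross terms are the products along the four sides of the square; a side shared by two
  -- squares then cancels modulo two.
  have h : ∀ x y, (f x y + f (x + 1) (y + 1)) * (f (x + 1) y + f x (y + 1)) =
      (f x y * f x (y + 1) + f (x + 1) y * f (x + 1) (y + 1)) +
      (f x y * f (x + 1) y + f x (y + 1) * f (x + 1) (y + 1)) := fun x y => by ring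
  simp only [h, Finset.sum_add_distrib (f := fun y => f _ y * f _ (y + 1) + _)]
  rw [Finset.sum_add_distrib]
  congr 1
  · rw [Finset.sum_comm, ← Finset.sum_add_distrib]
    exact Finset.sum_congr rfl fun y _ =>
      sum_range_add_succ (fun x => f x y * f x (y + 1)) l
  · rw [← Finset.sum_add_distrib]
    exact Finset.sum_congr rfl fun x _ =>
      sum_range_add_succ (fun y => f x y * f (x + 1) y) w

/-- If on every unit side of a segment one of the two values is one, then the products along
the segment are determined by the values at its ends. -/
lemma sum_products_of_one (f : ℕ → ZMod 2) (n : ℕ)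
    (h : ∀ k < n, f k = 1 ∨ f (k + 1) = 1) :
    ∑ k ∈ Finset.range n, f k * f (k + 1) = f 0 + f n + n := by
  have : ∀ k ∈ Finset.range n, f k * f (k + 1) = (f k + f (k + 1)) + 1 := by
    intro k hk
    have h2 : (2 : ZMod 2) = 0 := rfl
    rcases h k (Finset.mem_range.1 hk) with h | h <;> rw [h]
    · linear_combination -h2
    · linear_combination -h2
  rw [Finset.sum_congr rfl this, Finset.sum_add_distrib, sum_range_add_succ]
  simp

/-- Values on the lattice points of the rectangle which, for the points of one parity, are one
on the left and zero on the right and, for the points of the other parity, are one at the bottom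
and zero at the top, differ along both diagonals of some unit square. -/
lemma exists_square_of_boundary (f : ℕ → ℕ → ZMod 2) (l w : ℕ) (ε : ℤ)
    (hl : ∀ y ≤ w, ((y : ℤ) + ε) % 2 = 0 → f 0 y = 1)
    (hr : ∀ y ≤ w, ((l : ℤ) + y + ε) % 2 = 0 → f l y = 0)
    (hb : ∀ x ≤ l, ((x : ℤ) + ε) % 2 = 1 → f x 0 = 1)
    (ht : ∀ x ≤ l, ((x : ℤ) + w + ε) % 2 = 1 → f x w = 0) :
    ∃ x < l, ∃ y < w, f x y ≠ f (x + 1) (y + 1) ∧ f (x + 1) y ≠ f x (y + 1) := by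
  by_contra! hcon
  have h0 : ∑ x ∈ Finset.range l, ∑ y ∈ Finset.range w,
      (f x y + f (x + 1) (y + 1)) * (f (x + 1) y + f x (y + 1)) = 0 := by
    refine Finset.sum_eq_zero fun x hx => Finset.sum_eq_zero fun y hy => ?_
    have := hcon x (Finset.mem_range.1 hx) y (Finset.mem_range.1 hy)
    by_cases h : f x y = f (x + 1) (y + 1)
    · rw [h, CharTwo.add_self_eq_zero, zero_mul]
    · rw [this h, CharTwo.add_self_eq_zero, mul_zero]
  rw [sum_diagonal_products, sum_products_of_one (fun y => f 0 y) w,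
    sum_products_of_one (fun x => f x 0) l, Finset.sum_eq_zero (f := fun y => f l y * f l (y + 1)),
    Finset.sum_eq_zero (f := fun x => f x w * f (x + 1) w)] at h0
  -- Right and top contribute zero, left and bottom their end values and lengths. The corners `(0,
  -- w)` and `(l, 0)` lie on two sides each; whichever side has the right parity there, the value is
  -- the same expression in `ε`.
  · have h1 : f 0 w = ((w + ε + 1 : ℤ) : ZMod 2) := by
      rcases Int.emod_two_eq_zero_or_one (w + ε) with h | h
      · rw [hl w le_rfl h, ← Int.cast_one, ZMod.intCast_eq_intCast_iff']
        omega
      · rw [ht 0 (Nat.zero_le _) (by push_cast; omega), ← Int.cast_zero,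
          ZMod.intCast_eq_intCast_iff']
        omega
    have h2 : f l 0 = ((l + ε : ℤ) : ZMod 2) := by
      rcases Int.emod_two_eq_zero_or_one (l + ε) with h | h
      · rw [hr 0 (Nat.zero_le _) (by push_cast; omega), ← Int.cast_zero,
          ZMod.intCast_eq_intCast_iff']
        omega
      · rw [hb l le_rfl h, ← Int.cast_one, ZMod.intCast_eq_intCast_iff']
        omega
    have h3 : (2 : ZMod 2) = 0 := rfl
    simp only [h1, h2] at h0
    push_cast at h0
    refine one_ne_zero (α := ZMod 2) ?_
    linear_combination h0 - (f 0 0 + w + ε + l) * h3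
  · intro x hx
    have hx := Finset.mem_range.1 hx
    rcases Int.emod_two_eq_zero_or_one (x + w + ε) with h | h
    · rw [ht (x + 1) hx (by push_cast; omega), mul_zero]
    · rw [ht x hx.le h, zero_mul]
  · intro y hy
    have hy := Finset.mem_range.1 hy
    rcases Int.emod_two_eq_zero_or_one (l + y + ε) with h | h
    · rw [hr y hy.le h, zero_mul]
    · rw [hr (y + 1) hy (by push_cast; omega), mul_zero]
  · intro x hx
    rcases Int.emod_two_eq_zero_or_one (x + ε) with h | h
    · exact .inr (hb (x + 1) hx (by push_cast; omega))
    · exact .inl (hb x hx.le h)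
  · intro y hy
    rcases Int.emod_two_eq_zero_or_one (y + ε) with h | h
    · exact .inl (hl y hy.le h)
    · exact .inr (hl (y + 1) hy (by push_cast; omega))

/-! ### At least one of the two networks connects. -/

lemma linked_symm {P : Set Edge} {a b : Point} (h : Linked P a b) : Linked P b a := by
  rwa [Linked, Sym2.eq_swap]

/-- `P` links to `a` some point of `A`. -/
def ReachedFrom (A : Set Point) (P : Set Edge) (a : Point) : Prop :=
  ∃ s ∈ A, ReflTransGen (Linked P) s a

lemma reachedFrom_iff_of_linked {A : Set Point} {P : Set Edge} {a b : Point}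
    (h : Linked P a b) : ReachedFrom A P a ↔ ReachedFrom A P b :=
  ⟨fun ⟨s, hs, hr⟩ => ⟨s, hs, hr.tail h⟩, fun ⟨s, hs, hr⟩ => ⟨s, hs, hr.tail (linked_symm h)⟩⟩

section Duality

variable {l w : ℕ} {i : Kind} {S : Set Edge}

lemma dual_edges_diff_subset : (dualHammock l w i).edges \ compl '' S ⊆ allEdges l w :=
  fun _ h => h.1.1

open Classical in
/-- If the hammock network is not connected by `S`, its dual is connected by the edges that are
not complementary to an edge in `S`. -/
lemma dual_connects_of_not_connects (hS : S ⊆ kindEdges l w i)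
    (h : ¬ (hammock l w i).Connects S) :
    (dualHammock l w i).Connects ((dualHammock l w i).edges \ compl '' S) := by
  by_contra hd
  rw [Network.connects_iff (fun e he => (hS he).1)] at h
  rw [Network.connects_iff dual_edges_diff_subset] at hd
  obtain ⟨ε, hε⟩ := i.exists_hasParity_iff
  have hparity : ∀ a : Point, (a.1 + a.2 + ε) % 2 = 1 ↔ ¬ i.HasParity a := fun a => by
    rw [hε]; omega
  set D := (dualHammock l w i).edges \ compl '' S
  let f : Point → ZMod 2 := fun a =>
    if i.HasParity a then if ReachedFrom (hammock l w i).sources S a then 1 else 0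
    else if ReachedFrom (dualHammock l w i).sources D a then 1 else 0
  have hfS : ∀ a b : Point, s(a, b) ∈ S → f a = f b := by
    intro a b hab
    have ha := (hS hab).2 a (Sym2.mem_mk_left a b)
    have hb := (hS hab).2 b (Sym2.mem_mk_right a b)
    simp only [f, ha, hb, if_true, reachedFrom_iff_of_linked (show Linked S a b from hab)]
  have hfD : ∀ a b : Point, s(a, b) ∈ D → f a = f b := by
    intro a b hab
    have ha := (hparity a).1 ((mk_mem_dual_edges hε).1 hab.1).2
    have hb := (hparity b).1 ((mk_mem_dual_edges hε).1 (Sym2.eq_swap ▸ hab.1)).2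
    simp only [f, ha, hb, if_false, reachedFrom_iff_of_linked (show Linked D a b from hab)]
  obtain ⟨x, hx, y, hy, h1, h2⟩ :=
    exists_square_of_boundary (fun x y => f ((x : ℤ), (y : ℤ))) l w ε
      (fun y hy hp => by
        have hp : i.HasParity ((0 : ℕ), (y : ℤ)) := (hε _).2 (by simpa using hp)
        have hr : ReachedFrom (hammock l w i).sources S ((0 : ℕ), (y : ℤ)) :=
          ⟨_, ⟨⟨⟨by simp, by simp, by simp, by simpa using hy⟩, hp⟩, by simp⟩, .refl⟩
        simp only [f, hp, hr, if_true])
      (fun y hy hp => by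
        have hp : i.HasParity ((l : ℤ), (y : ℤ)) := (hε _).2 hp
        have hr : ¬ ReachedFrom (hammock l w i).sources S ((l : ℤ), (y : ℤ)) :=
          fun ⟨s, hs, hr⟩ => h ⟨s, hs, _,
            ⟨⟨⟨by simp, by simp, by simp, by simpa using hy⟩, hp⟩, rfl⟩, hr⟩
        simp only [f, hp, hr, if_true, if_false])
      (fun x hx hp => by
        have hp : ¬ i.HasParity ((x : ℤ), ((0 : ℕ) : ℤ)) := (hparity _).1 (by simpa using hp)
        have hr : ReachedFrom (dualHammock l w i).sources D ((x : ℤ), ((0 : ℕ) : ℤ)) :=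
          ⟨_, ⟨⟨⟨by simp, by simpa using hx, by simp, by simp⟩, fun hc => hp hc.2⟩, by simp⟩,
            .refl⟩
        simp only [f, hp, hr, if_true, if_false])
      (fun x hx hp => by
        have hp : ¬ i.HasParity ((x : ℤ), (w : ℤ)) := (hparity _).1 hp
        have hr : ¬ ReachedFrom (dualHammock l w i).sources D ((x : ℤ), (w : ℤ)) :=
          fun ⟨s, hs, hr⟩ => hd ⟨s, hs, _,
            ⟨⟨⟨by simp, by simpa using hx, by simp, by simp⟩, fun hc => hp hc.2⟩, rfl⟩, hr⟩
        simp only [f, hp, hr, if_false])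
  push_cast at h1 h2
  -- The parity decides which diagonal belongs to the hammock network. Its ends have different
  -- labels, so it is not in `S`; hence the other diagonal is in `D` and has equal labels.
  rcases Int.emod_two_eq_zero_or_one (x + y + ε) with hp | hp
  · refine h2 (hfD _ _ ((mk_mem_dual_edges_diff hε).2
      ⟨⟨mk_mem_allEdges.2 ?_, by simp only; omega⟩, fun hc => h1 (hfS _ _ hc)⟩))
    simp [allNodes]
    omega
  · refine h1 (hfD _ _ ((mk_mem_dual_edges_diff hε).2
      ⟨⟨mk_mem_allEdges.2 ?_, by simp only; omega⟩, fun hc => h2 (hfS _ _ hc)⟩))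
    simp [allNodes]
    omega

/-! ### At most one of the two networks connects: crossing counts. -/

/-- Whether `a` lies on the same horizontal line as `p`, strictly to the left of it. -/
def leftOf (p a : Point) : ZMod 2 := if a.2 = p.2 ∧ a.1 < p.1 then 1 else 0

/-- Whether `a` lies at most as high as `p`. -/
def below (p a : Point) : ZMod 2 := if a.2 ≤ p.2 then 1 else 0

/-- Whether the segment `ab` lies in the row of unit squares just above the height of `p`,
to the left of `p`. -/
def segmentLeftOf (p a b : Point) : ZMod 2 :=
  if min a.2 b.2 = p.2 ∧ min a.1 b.1 < p.1 then 1 else 0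

/-- In either row bordering the height of `q`, a segment counts exactly when its end at that height
is left of `q`. Parity keeps this end away from `q`, and `hne` excludes the one exception, the two
diagonals of a common square. -/
lemma segmentLeftOf_add {ε : ℤ} {p q a b : Point} (hp : (p.1 + p.2 + ε) % 2 = 0)
    (hpq1 : |p.1 - q.1| = 1) (hpq2 : q.2 = p.2 + 1) (ha : (a.1 + a.2 + ε) % 2 = 1)
    (hab1 : |a.1 - b.1| = 1) (hab2 : |a.2 - b.2| = 1)
    (hne : s((b.1, a.2), (a.1, b.2)) ≠ s(p, q)) :
    segmentLeftOf p a b + segmentLeftOf q a b = leftOf q a + leftOf q b := by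
  obtain ⟨p1, p2⟩ := p
  obtain ⟨q1, q2⟩ := q
  obtain ⟨a1, a2⟩ := a
  obtain ⟨b1, b2⟩ := b
  rw [abs_eq (by norm_num)] at hpq1 hab1 hab2
  simp only [ne_eq, Sym2.eq_iff, Prod.mk.injEq] at *
  simp only [segmentLeftOf, leftOf]
  split_ifs <;> first | rfl | (exfalso; omega)

/-- Crossing counts modulo two. Following a path in the dual, the number of its segments in the
row of `p` to the left of `p` changes along the edges in `S` only through the two ends of the
path. -/
lemma exists_crossing_count {ε : ℤ} (hε : ∀ a : Point, i.HasParity a ↔ (a.1 + a.2 + ε) % 2 = 0)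
    (hS : S ⊆ kindEdges l w i) {a b : Point}
    (h : ReflTransGen (Linked ((dualHammock l w i).edges \ compl '' S)) a b) :
    ∃ F : Point → ZMod 2,
      (∀ p q : Point, s(p, q) ∈ S → q.2 = p.2 + 1 → F p + F q = leftOf q a + leftOf q b) ∧
      (∀ p : Point, p.1 = 0 → F p = 0) ∧
      (∀ p : Point, p.1 = l → F p = below p a + below p b) := by
  induction h with
  | refl => exact ⟨fun _ => 0, by simp [CharTwo.add_self_eq_zero]⟩
  | @tail c d _ hcd ih =>
    obtain ⟨F, h1, h2, h3⟩ := ih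
    obtain ⟨⟨hcd1, hc⟩, hcd2⟩ := (mk_mem_dual_edges_diff hε).1 hcd
    obtain ⟨hcn, hdn, hx, hy⟩ := mk_mem_allEdges.1 hcd1
    refine ⟨fun p => F p + segmentLeftOf p c d, fun p q hpq hq => ?_, fun p hp => ?_,
      fun p hp => ?_⟩
    · obtain ⟨hpq', hp⟩ := (mk_mem_kindEdges hε).1 (hS hpq)
      have := segmentLeftOf_add hp (mk_mem_allEdges.1 hpq').2.2.1 hq hc hx hy
        (fun he => hcd2 (he ▸ hpq))
      linear_combination h1 p q hpq hq + this + CharTwo.add_self_eq_zero (leftOf q c)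
    · have : segmentLeftOf p c d = 0 := by
        rw [segmentLeftOf, if_neg]
        have := hcn.1
        have := hdn.1
        omega
      simp only [h2 p hp, this, add_zero]
    -- On the right side every segment in the row of `p` lies to the left, so being counted means
    -- having exactly one end at most as high as `p`.
    · have : segmentLeftOf p c d = below p c + below p d := by
        have := hcn.2.1
        have := hdn.2.1
        rw [abs_eq (by norm_num)] at hx hy
        simp only [segmentLeftOf, below]
        split_ifs <;> first | rfl | (exfalso; omega)
      linear_combination h3 p hp + this + CharTwo.add_self_eq_zero (below p c)

/-- A left-right path in the hammock network and a bottom-top path in its dual cross. -/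
lemma not_dual_connects_of_connects (hS : S ⊆ kindEdges l w i)
    (h : (hammock l w i).Connects S) :
    ¬ (dualHammock l w i).Connects ((dualHammock l w i).edges \ compl '' S) := by
  rw [Network.connects_iff (fun e he => (hS he).1)] at h
  rw [Network.connects_iff dual_edges_diff_subset]
  rintro ⟨a, ha, b, hb, hab⟩
  obtain ⟨s, hs, t, ht, hst⟩ := h
  obtain ⟨ε, hε⟩ := i.exists_hasParity_iff
  obtain ⟨F, h1, h2, h3⟩ := exists_crossing_count hε hS hab
  obtain ⟨⟨han, -⟩, ha0⟩ := ha
  obtain ⟨⟨hbn, hbp⟩, hbw⟩ := hb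
  obtain ⟨⟨hsn, -⟩, hs0⟩ := hs
  obtain ⟨⟨htn, htp⟩, htl⟩ := ht
  -- Here `a` is at the bottom and `b` at the top, so `a` is never level with the upper end `q`, nor
  -- `b` with the lower end `p`.
  have hup : ∀ p q : Point, s(p, q) ∈ S → q.2 = p.2 + 1 →
      F p + leftOf p b = F q + leftOf q b := by
    intro p q hpq hq
    obtain ⟨hpn, hqn, -⟩ := mk_mem_allEdges.1 (hS hpq).1
    have hpb : leftOf p b = 0 := if_neg (by have := hqn.2.2.2; omega)
    have hqa : leftOf q a = 0 := if_neg (by have := hpn.2.2.1; omega)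
    linear_combination h1 p q hpq hq + hpb + hqa - CharTwo.add_self_eq_zero (F q)
  have hconst : F s + leftOf s b = F t + leftOf t b := by
    clear htl htn htp
    induction hst with
    | refl => rfl
    | @tail p q _ hpq ih =>
      rw [ih]
      obtain ⟨-, -, -, hy⟩ := mk_mem_allEdges.1 (hS hpq).1
      rw [abs_eq (by norm_num)] at hy
      rcases hy with hy | hy
      · exact (hup q p (linked_symm hpq) (by omega)).symm
      · exact hup p q hpq (by omega)
  have hsb : leftOf s b = 0 := if_neg (by have := hbn.1; omega)
  have hta : below t a = 1 := if_pos (by have := htn.2.2.1; omega)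
  have hbt : b ≠ t := fun hc => hbp (hc ▸ ⟨htn, htp⟩)
  -- Both terms are one if `t` is at the top, since `b` then lies strictly to its left; otherwise
  -- both vanish.
  have htb : below t b + leftOf t b = 0 := by
    have := htn.2.2.2
    have := hbn.2.1
    have : ¬ (b.1 = t.1 ∧ b.2 = t.2) := fun hc => hbt (Prod.ext hc.1 hc.2)
    simp only [below, leftOf]
    split_ifs <;> first | rfl | (exfalso; omega)
  rw [h2 s hs0, hsb, h3 t htl, hta, add_assoc, htb] at hconst
  exact absurd hconst (by decide)

end Duality

end Hammock

theorem corollary1 (l w : ℕ) (i : Hammock.Kind) (S : Set Hammock.Edge)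
    (hS : S ⊆ (Hammock.hammock l w i).edges) :
    Hammock.compl '' S ⊆ (Hammock.dualHammock l w i).edges ∧
      ((Hammock.hammock l w i).IsPathset S ↔
        (Hammock.dualHammock l w i).IsCutset (Hammock.compl '' S)) := by
  have hsub : Hammock.compl '' S ⊆ (Hammock.dualHammock l w i).edges := by
    rintro _ ⟨e, he, rfl⟩
    exact Hammock.compl_mem_dual_edges (hS he)
  refine ⟨hsub, ?_, ?_⟩
  · exact fun h => ⟨hsub, Hammock.not_dual_connects_of_connects hS h.2⟩
  · exact fun h => ⟨hS, by_contra fun hc => h.2 (Hammock.dual_connects_of_not_connects hS hc)⟩
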